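/- Let $\gamma\in(1,2]$ and let $\mathbf U=(D,\mathbf m,\mathbf B,E)$ with $D,E\in\mathbb R$ and $\mathbf m,\mathbf B\in\mathbb R^3$. Write $B=|\mathbf B|$, $\tau=\mathbf m\cdot\mathbf B$, $\Phi=\sqrt{(B^2-E)^2+3(E^2-D^2-|\mathbf m|^2)}$, and assume that $\mathbf U$ lies in the admissible set $\mathcal G$, that is, $$D>0,\qquad E>\sqrt{D^2+|\mathbf m|^2},\qquad \big(\Phi-2(B^2-E)\big)\sqrt{\Phi+B^2-E}>\sqrt{\tfrac{27}{2}(D^2B^2+\tau^2)}.$$ Put $f_a(\xi)=\xi^2(\xi+B^2)^2-\big(\xi^2|\mathbf m|^2+(2\xi+B^2)\tau^2\big)$, $f_b(\xi)=f_a(\xi)-D^2(\xi+B^2)^2$ and $\Omega_1=\{\xi>0: f_a(\xi)>0\}$. For $\xi\in\Omega_1$ define $$\mathcal W(\xi)=\frac{\xi(\xi+B^2)}{\sqrt{f_a(\xi)}},\quad \mathbf v(\xi)=\frac{\mathbf m+\xi^{-1}\tau\mathbf B}{\xi+B^2},\quad \rho(\xi)=\frac{D}{\mathcal W(\xi)},\quad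 h(\xi)=\frac{\xi}{D\mathcal W(\xi)},$$ the pressure $p(\xi)=\frac{\gamma-1}{\gamma}\rho(\xi)\,(h(\xi)-1)$ given by the $\gamma$-law equation of state $h=1+\frac{\gamma p}{(\gamma-1)\rho}$, and $$\mathcal F(\xi)=\xi-p(\xi)-\frac12\Big(\frac{B^2}{\mathcal W(\xi)^2}+\frac{\tau^2}{\xi^2}\Big)+B^2-E .$$ Then $f_b$ has a unique root $\xi_b$ in $\Omega_1$, the interval $\Omega_2:=(\xi_b,\infty)$ is contained in $\Omega_1$, and $\mathcal F$ has a unique root $\xi_*$ (the physical root) in $\Omega_2$. For every initial guess $\xi_0\in\Omega_3:=(\xi_b,\xi_*]$ the Newton--Raphson iteration $\xi_{n+1}=\xi_n-\mathcal F(\xi_n)/\mathcal F'(\xi_n)$, $n\ge 0$, is well defined ($\mathcal F$ is differentiable at $\xi_n$ with $\mathcal F'(\xi_n)\ne 0$ for all $n$), all iterates lie in $\Omega_2$, it is physical-constraint-preserving, that is, $$\xi_n\in\Omega_1,\qquad \rho(\xi_n)>0,\qquad p(\xi_n)>0,\qquad |\mathbf v(\xi_n)|<1\qquad\text{for all } n\ge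 0,$$ and $\lim_{n\to\infty}\xi_n=\xi_*$. -/

import Mathlib

open Filter Topology

noncomputable section

namespace RMHD

/-- A vector of conservative variables `U = (D, m, B, E)` of relativistic magnetohydrodynamics.
Three-dimensional vectors carry the Euclidean norm and inner product. -/
structure Conserved where
  /-- mass density in the laboratory frame -/
  D : ℝ
  /-- momentum density -/
  m : EuclideanSpace ℝ (Fin 3)
  /-- magnetic field -/
  B : EuclideanSpace ℝ (Fin 3)
  /-- total energy density -/
  E : ℝ

/-- The specific enthalpy `h = 1 + γ p / ((γ - 1) ρ)` of the `γ`-law equation of state. -/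
def enthalpy (γ ρ p : ℝ) : ℝ := 1 + γ * p / ((γ - 1) * ρ)

/-- The `γ`-law equation of state solved for the pressure as a function of `ρ` and `h`. -/
def pressure (γ ρ h : ℝ) : ℝ := (γ - 1) / γ * ρ * (h - 1)

/-- `pressure` is the inverse of `enthalpy` in the pressure variable. -/
theorem enthalpy_eq_iff {γ ρ : ℝ} (hγ : 1 < γ) (hρ : 0 < ρ) (p h : ℝ) :
    h = enthalpy γ ρ p ↔ p = pressure γ ρ h := by
  have h1 : γ - 1 ≠ 0 := by linarith
  have h2 : γ ≠ 0 := by linarith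
  have h3 : ρ ≠ 0 := hρ.ne'
  unfold enthalpy pressure
  constructor
  · rintro rfl
    field_simp
    ring
  · rintro rfl
    field_simp
    ring

namespace Conserved

variable (U : Conserved)

/-- `τ = m · B`. -/
def tau : ℝ := inner ℝ U.m U.B

/-- `Φ(U) = √((|B|² - E)² + 3 (E² - D² - |m|²))`. -/
def Phi : ℝ :=
  √((‖U.B‖ ^ 2 - U.E) ^ 2 + 3 * (U.E ^ 2 - U.D ^ 2 - ‖U.m‖ ^ 2))

/-- `Ψ(U) = (Φ - 2 (|B|² - E)) √(Φ + |B|² - E) - √(27/2 (D² |B|² + (m · B)²))`. -/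
def Psi : ℝ :=
  (U.Phi - 2 * (‖U.B‖ ^ 2 - U.E)) * √(U.Phi + ‖U.B‖ ^ 2 - U.E)
    - √(27 / 2 * (U.D ^ 2 * ‖U.B‖ ^ 2 + U.tau ^ 2))

end Conserved

/-- The set `G` of physically admissible conservative vectors. -/
def admissible : Set Conserved :=
  {U | 0 < U.D ∧ 0 < U.E - √(U.D ^ 2 + ‖U.m‖ ^ 2) ∧ 0 < U.Psi}

namespace Conserved

variable (γ : ℝ) (U : Conserved) (ξ : ℝ)

/-- The quartic polynomial `f_a`. -/
def fa : ℝ :=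
  ξ ^ 2 * (ξ + ‖U.B‖ ^ 2) ^ 2
    - (ξ ^ 2 * ‖U.m‖ ^ 2 + (2 * ξ + ‖U.B‖ ^ 2) * U.tau ^ 2)

/-- The quartic polynomial `f_b`. -/
def fb : ℝ := U.fa ξ - U.D ^ 2 * (ξ + ‖U.B‖ ^ 2) ^ 2

/-- The domain `Ω₁ = {ξ > 0 : f_a(ξ) > 0}` on which the functions below are well defined. -/
def Omega1 : Set ℝ := {ξ | 0 < ξ ∧ 0 < U.fa ξ}

/-- The Lorentz factor `𝒲(ξ) = ξ (ξ + |B|²) / √(f_a(ξ))` as a function of `ξ`. -/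
def lorentz : ℝ := ξ * (ξ + ‖U.B‖ ^ 2) / √(U.fa ξ)

/-- The velocity `v(ξ)`. -/
def velocity : EuclideanSpace ℝ (Fin 3) :=
  (ξ + ‖U.B‖ ^ 2)⁻¹ • (U.m + (ξ⁻¹ * U.tau) • U.B)

/-- The rest-mass density `ρ(ξ) = D / 𝒲(ξ)`. -/
def density : ℝ := U.D / U.lorentz ξ

/-- The specific enthalpy `h(ξ) = ξ / (D 𝒲(ξ))`. -/
def specificEnthalpy : ℝ := ξ / (U.D * U.lorentz ξ)

/-- The thermal pressure `p(ξ)`, computed from `ρ(ξ)` and `h(ξ)` by the equation of state. -/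
def thermalPressure : ℝ := pressure γ (U.density ξ) (U.specificEnthalpy ξ)

/-- The iterative function `ℱ`. -/
def iterFun : ℝ :=
  ξ - U.thermalPressure γ ξ
    - 1 / 2 * (‖U.B‖ ^ 2 / U.lorentz ξ ^ 2 + U.tau ^ 2 / ξ ^ 2) + (‖U.B‖ ^ 2 - U.E)

end Conserved

/-- `x` lies in `S` and is the only root of `f` in `S`. -/
def IsUniqueRootOn (f : ℝ → ℝ) (S : Set ℝ) (x : ℝ) : Prop :=
  x ∈ S ∧ f x = 0 ∧ ∀ y ∈ S, f y = 0 → y = x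

/-- The Newton--Raphson iteration `ξ_{n+1} = ξ_n - f(ξ_n) / f'(ξ_n)` started at `ξ₀`. -/
def newtonSeq (f : ℝ → ℝ) (ξ₀ : ℝ) : ℕ → ℝ
  | 0 => ξ₀
  | n + 1 => newtonSeq f ξ₀ n - f (newtonSeq f ξ₀ n) / deriv f (newtonSeq f ξ₀ n)

/-- A sequence of iterates is physical-constraint-preserving: every iterate lies in `Ω₁`, and the
primitive variables computed from it satisfy `ρ > 0`, `p > 0` and `|v| < 1`. -/
def IsPCP (γ : ℝ) (U : Conserved) (ξ : ℕ → ℝ) : Prop :=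
  ∀ n, ξ n ∈ U.Omega1 ∧ 0 < U.density (ξ n) ∧ 0 < U.thermalPressure γ (ξ n) ∧
    ‖U.velocity (ξ n)‖ < 1

end RMHD

end

/-!
Write `b = |B|²` and split `|m|² = a + c` into the parts of `m` perpendicular and parallel to `B`, so
that `τ² = b c`. Then `1 / 𝒲² = g` with `g(x) = 1 - a / (x + b)² - c / x²`, `f_a = (x (x + b))² g`,
and `f_b` is the same expression with `c + D²` in place of `c`. Hence `f_b` has the sign of an
increasing function, `p > 0` exactly right of `ξ_b`, and `|v|² = 1 - g`. With `κ = (γ - 1) / γ`, which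
is at most `1 / 2`, the iterative function becomes

`ℱ(x) = x - κ (x g - D √g) + a b / (2 (x + b)²) + b / 2 - E`.

* Root: `Ψ > 0` says that a cubic is negative at its positive local minimum, that is, `E > K(y)` for
  some `y > 0`, where `K(y) = ((y + b) + (D² + c) / y + a / (y + b)) / 2`. The convex function `K` is
  minimal exactly at `ξ_b`, and `ℱ(ξ_b) = K(ξ_b) - E`, so `ℱ(ξ_b) < 0` (`redIter_neg`). As
  `ℱ' ≥ g / 2` on `Ω₂` (`redIterDeriv_lower_bound`), `ℱ` is increasing there and has a unique root.
* Curvature: `ℱ'' = P - N` with `P, N ≥ 0` and `N / P` decreasing, so that `ℱ` is first concave and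
  then convex (`concavePart_le_convexPart`). Consequently it is concave left of the root or convex
  right of it.
* Newton: for an increasing function of this kind, iterates started left of the root increase until
  they overshoot, if ever; an overshoot puts them into the convex region, where they decrease
  (`newtonSeq_tendsto`). Monotonicity forces convergence, and the only possible limit is the root.
-/

namespace RMHD

/-! ### Newton's method for an increasing function -/

section Newton

variable {f f' : ℝ → ℝ} {β s : ℝ}

theorem strictMonoOn_of_hasDerivAt_pos (hf : ∀ x, β < x → HasDerivAt f (f' x) x)
    (hpos : ∀ x, β < x → 0 < f' x) : StrictMonoOn f (Set.Ioi β) := by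
  refine strictMonoOn_of_deriv_pos (convex_Ioi β)
    (fun x hx => (hf x hx).continuousAt.continuousWithinAt) fun x hx => ?_
  rw [interior_Ioi] at hx
  rw [(hf x hx).deriv]
  exact hpos x hx

theorem exists_deriv_eq_of_lt (hf : ∀ x, β < x → HasDerivAt f (f' x) x) {x y : ℝ}
    (hx : β < x) (hxy : x < y) : ∃ z ∈ Set.Ioo x y, f y - f x = f' z * (y - x) := by
  obtain ⟨z, hz, h⟩ := exists_hasDerivAt_eq_slope f f' hxy
    (fun w hw => (hf w (hx.trans_le hw.1)).continuousAt.continuousWithinAt)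
    (fun w hw => hf w (hx.trans hw.1))
  refine ⟨z, hz, ?_⟩
  rw [h, div_mul_cancel₀ _ (sub_pos.2 hxy).ne']

/-- Left of the root a Newton step moves to the right. -/
theorem le_newton_step (hf : ∀ x, β < x → HasDerivAt f (f' x) x)
    (hpos : ∀ x, β < x → 0 < f' x) (hs : f s = 0) {x : ℝ} (hx : β < x) (hxs : x ≤ s) :
    x ≤ x - f x / f' x := by
  have h := (strictMonoOn_of_hasDerivAt_pos hf hpos).monotoneOn hx (hx.trans_le hxs) hxs
  rw [hs] at h
  linarith [div_nonpos_of_nonpos_of_nonneg h (hpos x hx).le]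

/-- Where `f` is concave between the iterate and the root, a step from the left does not
overshoot. -/
theorem newton_step_le (hf : ∀ x, β < x → HasDerivAt f (f' x) x)
    (hpos : ∀ x, β < x → 0 < f' x) (hs : f s = 0)
    (hanti : AntitoneOn f' (Set.Ioc β s)) {x : ℝ} (hx : β < x) (hxs : x ≤ s) :
    x - f x / f' x ≤ s := by
  rcases hxs.eq_or_lt with rfl | hlt
  · simp [hs]
  obtain ⟨z, hz, h⟩ := exists_deriv_eq_of_lt hf hx hlt
  have h1 : f' z ≤ f' x := hanti ⟨hx, hxs⟩ ⟨hx.trans hz.1, hz.2.le⟩ hz.1.le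
  have h2 : -f x ≤ (s - x) * f' x := by
    rw [hs] at h
    nlinarith [mul_le_mul_of_nonneg_right h1 (sub_pos.2 hlt).le]
  have h3 := (div_le_iff₀ (hpos x hx)).2 h2
  rw [neg_div] at h3
  linarith

/-- Where `f` is convex right of the root, a step from the right stays between the root and the
iterate. -/
theorem newton_step_mem_Icc (hf : ∀ x, β < x → HasDerivAt f (f' x) x)
    (hpos : ∀ x, β < x → 0 < f' x) (hβs : β < s) (hs : f s = 0)
    (hmono : MonotoneOn f' (Set.Ici s)) {x : ℝ} (hsx : s ≤ x) :
    x - f x / f' x ∈ Set.Icc s x := by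
  have hx : β < x := hβs.trans_le hsx
  rcases hsx.eq_or_lt with rfl | hlt
  · simp [hs]
  obtain ⟨z, hz, h⟩ := exists_deriv_eq_of_lt hf hβs hlt
  have h1 : f' z ≤ f' x := hmono hz.1.le hsx hz.2.le
  rw [hs, sub_zero] at h
  have h2 : f x ≤ (x - s) * f' x := by
    nlinarith [mul_le_mul_of_nonneg_right h1 (sub_pos.2 hlt).le]
  have h3 := (div_le_iff₀ (hpos x hx)).2 h2
  have h4 : 0 ≤ f x := by
    rw [h]
    exact mul_nonneg (hpos z (hβs.trans hz.1)).le (sub_pos.2 hlt).le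
  have h5 := div_nonneg h4 (hpos x hx).le
  constructor <;> linarith

theorem newtonSeq_succ_eq (hf : ∀ x, β < x → HasDerivAt f (f' x) x) {x₀ : ℝ} {n : ℕ}
    (hn : β < newtonSeq f x₀ n) :
    newtonSeq f x₀ (n + 1) =
      newtonSeq f x₀ n - f (newtonSeq f x₀ n) / f' (newtonSeq f x₀ n) := by
  simp only [newtonSeq, (hf _ hn).deriv]

/-- A limit of Newton iterates inside the domain is a fixed point, hence the root. -/
theorem newtonSeq_limit_eq (hf : ∀ x, β < x → HasDerivAt f (f' x) x)
    (hpos : ∀ x, β < x → 0 < f' x) (hcont : ∀ x, β < x → ContinuousAt f' x)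
    (hβs : β < s) (hs : f s = 0) {x₀ L : ℝ} (hβ : ∀ n, β < newtonSeq f x₀ n) (hL : β < L)
    (hlim : Tendsto (newtonSeq f x₀) atTop (𝓝 L)) : L = s := by
  have h1 : Tendsto (fun n => newtonSeq f x₀ (n + 1)) atTop (𝓝 (L - f L / f' L)) := by
    simp only [newtonSeq_succ_eq hf (hβ _)]
    exact hlim.sub (((hf L hL).continuousAt.tendsto.comp hlim).div
      ((hcont L hL).tendsto.comp hlim) (hpos L hL).ne')
  have h2 := tendsto_nhds_unique h1 ((tendsto_add_atTop_iff_nat 1).2 hlim)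
  have h3 : f L / f' L = 0 := by linarith
  have h4 : f L = 0 := by simpa [(hpos L hL).ne'] using h3
  exact (strictMonoOn_of_hasDerivAt_pos hf hpos).injOn hL hβs (h4.trans hs.symm)

/-- Convergence of Newton's method from the left of the root `s` of an increasing function that is
concave left of `s` or convex right of `s`. In the second case the iterates may overshoot once,
and they decrease to `s` afterwards. -/
theorem newtonSeq_tendsto (hf : ∀ x, β < x → HasDerivAt f (f' x) x)
    (hpos : ∀ x, β < x → 0 < f' x) (hcont : ∀ x, β < x → ContinuousAt f' x)
    (hs : f s = 0) (hcurv : AntitoneOn f' (Set.Ioc β s) ∨ MonotoneOn f' (Set.Ici s))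
    {x₀ : ℝ} (hx₀ : x₀ ∈ Set.Ioc β s) :
    (∀ n, β < newtonSeq f x₀ n) ∧ Tendsto (newtonSeq f x₀) atTop (𝓝 s) := by
  have hβs : β < s := hx₀.1.trans_le hx₀.2
  have stay : ∀ n, β < newtonSeq f x₀ n := by
    intro n
    induction n with
    | zero => exact hx₀.1
    | succ n ih =>
      rw [newtonSeq_succ_eq hf ih]
      rcases le_total (newtonSeq f x₀ n) s with h | h
      · exact ih.trans_le (le_newton_step hf hpos hs ih h)
      · rcases hcurv with hc | hc
        · -- the iterates cannot lie strictly right of `s` in the concave case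
          have hle : ∀ k ≤ n, newtonSeq f x₀ k ∈ Set.Ioc β s := by
            intro k
            induction k with
            | zero => exact fun _ => hx₀
            | succ k ihk =>
              intro hk
              have hm := ihk (by omega)
              rw [newtonSeq_succ_eq hf hm.1]
              exact ⟨hm.1.trans_le (le_newton_step hf hpos hs hm.1 hm.2),
                newton_step_le hf hpos hs hc hm.1 hm.2⟩
          have he : newtonSeq f x₀ n = s := le_antisymm (hle n le_rfl).2 h
          rw [he, hs]
          simpa using hβs
        · exact hβs.trans_le (newton_step_mem_Icc hf hpos hβs hs hc h).1
  refine ⟨stay, ?_⟩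
  by_cases hall : ∀ n, newtonSeq f x₀ n ≤ s
  · have hmono : Monotone (newtonSeq f x₀) := monotone_nat_of_le_succ fun n => by
      rw [newtonSeq_succ_eq hf (stay n)]
      exact le_newton_step hf hpos hs (stay n) (hall n)
    have hbdd : BddAbove (Set.range (newtonSeq f x₀)) := ⟨s, by rintro _ ⟨n, rfl⟩; exact hall n⟩
    have hlim := tendsto_atTop_ciSup hmono hbdd
    have hL := newtonSeq_limit_eq hf hpos hcont hβs hs stay
      ((stay 0).trans_le (le_ciSup hbdd 0)) hlim
    rwa [hL] at hlim
  · push Not at hall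
    obtain ⟨k, hk⟩ := hall
    rcases hcurv with hc | hc
    · exfalso
      have hle : ∀ n, newtonSeq f x₀ n ≤ s := by
        intro n
        induction n with
        | zero => exact hx₀.2
        | succ n ih =>
          rw [newtonSeq_succ_eq hf (stay n)]
          exact newton_step_le hf hpos hs hc (stay n) ih
      exact absurd (hle k) hk.not_ge
    · have hge : ∀ n, s ≤ newtonSeq f x₀ (n + k) := by
        intro n
        induction n with
        | zero => simpa using hk.le
        | succ n ih =>
          rw [Nat.add_right_comm, newtonSeq_succ_eq hf (stay _)]
          exact (newton_step_mem_Icc hf hpos hβs hs hc ih).1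
      have hanti : Antitone fun n => newtonSeq f x₀ (n + k) := antitone_nat_of_succ_le fun n => by
        rw [Nat.add_right_comm, newtonSeq_succ_eq hf (stay _)]
        exact (newton_step_mem_Icc hf hpos hβs hs hc (hge n)).2
      have hbdd : BddBelow (Set.range fun n => newtonSeq f x₀ (n + k)) :=
        ⟨s, by rintro _ ⟨n, rfl⟩; exact hge n⟩
      have hlim := (tendsto_add_atTop_iff_nat k).1 (tendsto_atTop_ciInf hanti hbdd)
      have hL := newtonSeq_limit_eq hf hpos hcont hβs hs stay
        (hβs.trans_le (le_ciInf hge)) hlim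
      rwa [hL] at hlim

end Newton

/-! ### The reduced Lorentz factor -/

/-- `g(x) = 1 - a / (x + b)² - c / x²`. If `|m|² = a + c` splits into the parts perpendicular and
parallel to `B`, and `b = |B|²`, this is `1 / 𝒲(x)² = 1 - |v(x)|²`; with `c + D²` in place of `c` it
is the corresponding factor of `f_b`. -/
noncomputable def invLorentzSq (a b c x : ℝ) : ℝ := 1 - a * (x + b)⁻¹ ^ 2 - c * x⁻¹ ^ 2

/-- Half the derivative of `invLorentzSq`. -/
noncomputable def cubicDecay (a b c x : ℝ) : ℝ := a * (x + b)⁻¹ ^ 3 + c * x⁻¹ ^ 3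

/-- Minus one third of the derivative of `cubicDecay`. -/
noncomputable def quarticDecay (a b c x : ℝ) : ℝ := a * (x + b)⁻¹ ^ 4 + c * x⁻¹ ^ 4

section Reduced

variable {a b c D E κ x y : ℝ}

theorem hasDerivAt_inv_add_pow (n : ℕ) (h : x + b ≠ 0) :
    HasDerivAt (fun x => (x + b)⁻¹ ^ n) (-(n * (x + b)⁻¹ ^ (n + 1))) x := by
  have h1 : HasDerivAt (fun x : ℝ => (x + b)⁻¹) (-1 / (x + b) ^ 2) x :=
    ((hasDerivAt_id x).add_const b).inv h
  refine (h1.pow n).congr_deriv ?_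
  rcases n with _ | n
  · simp
  · rw [Nat.add_sub_cancel, neg_div, one_div, ← inv_pow]
    ring

theorem hasDerivAt_inv_pow (n : ℕ) (h : x ≠ 0) :
    HasDerivAt (fun x : ℝ => x⁻¹ ^ n) (-(n * x⁻¹ ^ (n + 1))) x := by
  simpa using hasDerivAt_inv_add_pow (b := 0) n (x := x) (by simpa using h)

theorem hasDerivAt_invLorentzSq (hb : 0 ≤ b) (hx : 0 < x) :
    HasDerivAt (invLorentzSq a b c) (2 * cubicDecay a b c x) x := by
  have h1 := (hasDerivAt_inv_add_pow 2 (by positivity : x + b ≠ 0)).const_mul a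
  have h2 := (hasDerivAt_inv_pow 2 hx.ne').const_mul c
  refine ((h1.const_sub 1).sub h2).congr_deriv ?_
  unfold cubicDecay
  push_cast
  ring

theorem hasDerivAt_cubicDecay (hb : 0 ≤ b) (hx : 0 < x) :
    HasDerivAt (cubicDecay a b c) (-(3 * quarticDecay a b c x)) x := by
  have h1 := (hasDerivAt_inv_add_pow 3 (by positivity : x + b ≠ 0)).const_mul a
  have h2 := (hasDerivAt_inv_pow 3 hx.ne').const_mul c
  refine (h1.add h2).congr_deriv ?_
  unfold quarticDecay
  push_cast
  ring

theorem cubicDecay_nonneg (ha : 0 ≤ a) (hb : 0 ≤ b) (hc : 0 ≤ c) (hx : 0 < x) :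
    0 ≤ cubicDecay a b c x := by
  unfold cubicDecay
  positivity

theorem quarticDecay_nonneg (ha : 0 ≤ a) (hb : 0 ≤ b) (hc : 0 ≤ c) (hx : 0 < x) :
    0 ≤ quarticDecay a b c x := by
  unfold quarticDecay
  positivity

theorem invLorentzSq_mono (ha : 0 ≤ a) (hb : 0 ≤ b) (hc : 0 ≤ c) (hx : 0 < x) (hxy : x ≤ y) :
    invLorentzSq a b c x ≤ invLorentzSq a b c y := by
  have : 0 < x + b := by positivity
  have : 0 < y := hx.trans_le hxy
  unfold invLorentzSq
  gcongr

theorem invLorentzSq_strictMono (ha : 0 ≤ a) (hb : 0 ≤ b) (hc : 0 < c) (hx : 0 < x)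
    (hxy : x < y) : invLorentzSq a b c x < invLorentzSq a b c y := by
  have h1 := invLorentzSq_mono ha hb (le_refl 0) hx hxy.le
  have h2 : y⁻¹ ^ 2 < x⁻¹ ^ 2 := by
    have : 0 < y := hx.trans hxy
    gcongr
  unfold invLorentzSq at *
  nlinarith

/-- Existence of the root of `f_b`, where the pressure vanishes. -/
theorem exists_invLorentzSq_eq_zero (ha : 0 ≤ a) (hb : 0 ≤ b) (hc : 0 ≤ c) (hD : 0 < D) :
    ∃ x, 0 < x ∧ invLorentzSq a b (c + D ^ 2) x = 0 := by
  set L := a + c + D ^ 2 + 1 with hL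
  have hL1 : 1 ≤ L := by nlinarith [sq_nonneg D]
  have hDL : D ≤ L := by nlinarith [sq_nonneg (D - 1)]
  have hcont : ContinuousOn (invLorentzSq a b (c + D ^ 2)) (Set.Icc D L) := fun x hx =>
    (hasDerivAt_invLorentzSq hb (hD.trans_le hx.1)).continuousAt.continuousWithinAt
  have hlo : invLorentzSq a b (c + D ^ 2) D ≤ 0 := by
    have h1 : D ^ 2 * D⁻¹ ^ 2 = 1 := by field_simp
    have h2 : 0 ≤ a * (D + b)⁻¹ ^ 2 := by positivity
    have h3 : 0 ≤ c * D⁻¹ ^ 2 := by positivity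
    unfold invLorentzSq
    linarith
  have hhi : 0 ≤ invLorentzSq a b (c + D ^ 2) L := by
    have hL0 : 0 < L := by linarith
    have h1 : (L + b)⁻¹ ^ 2 ≤ L⁻¹ ^ 2 := by
      gcongr
      linarith
    have h2 : L⁻¹ ^ 2 * L ≤ 1 := by
      have : L⁻¹ ≤ 1 := inv_le_one_of_one_le₀ hL1
      rw [sq, mul_assoc, inv_mul_cancel₀ hL0.ne', mul_one]
      exact this
    have h3 : 0 ≤ L⁻¹ ^ 2 := by positivity
    unfold invLorentzSq
    nlinarith [mul_le_mul_of_nonneg_left h1 ha]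
  obtain ⟨x, hx, h⟩ := intermediate_value_Icc hDL hcont ⟨hlo, hhi⟩
  exact ⟨x, hD.trans_le hx.1, h⟩

theorem invLorentzSq_pos (hD : 0 < D) (hx : 0 < x)
    (h : 0 ≤ invLorentzSq a b (c + D ^ 2) x) : 0 < invLorentzSq a b c x := by
  have : 0 < D ^ 2 * x⁻¹ ^ 2 := by positivity
  unfold invLorentzSq at *
  linarith

/-! ### The reduced iterative function -/

/-- The function `ℱ` in the reduced parameters, with `κ = (γ - 1) / γ`. -/
noncomputable def redIter (κ a b c D E x : ℝ) : ℝ :=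
  x - κ * (x * invLorentzSq a b c x - D * √(invLorentzSq a b c x))
    + a * b / 2 * (x + b)⁻¹ ^ 2 + b / 2 - E

/-- The derivative of `redIter`. -/
noncomputable def redIterDeriv (κ a b c D x : ℝ) : ℝ :=
  1 - κ * (invLorentzSq a b c x + 2 * x * cubicDecay a b c x
    - D * (cubicDecay a b c x / √(invLorentzSq a b c x))) - a * b * (x + b)⁻¹ ^ 3

/-- One of two terms of the second derivative `convexPart - concavePart` of `redIter`; it is
nonnegative for `0 ≤ κ ≤ 1 / 2`. -/
noncomputable def convexPart (κ a b c x : ℝ) : ℝ :=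
  2 * κ * cubicDecay a b c x + (3 - 6 * κ) * (a * b * (x + b)⁻¹ ^ 4)

/-- The subtracted, nonnegative term of the second derivative of `redIter`. -/
noncomputable def concavePart (κ a b c D x : ℝ) : ℝ :=
  κ * D * (3 * quarticDecay a b c x / √(invLorentzSq a b c x)
    + cubicDecay a b c x ^ 2 / √(invLorentzSq a b c x) ^ 3)

theorem hasDerivAt_redIter (hb : 0 ≤ b) (hx : 0 < x) (hg : 0 < invLorentzSq a b c x) :
    HasDerivAt (redIter κ a b c D E) (redIterDeriv κ a b c D x) x := by
  have hG := hasDerivAt_invLorentzSq (a := a) (c := c) hb hx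
  have hS := hG.sqrt hg.ne'
  have h1 := (hasDerivAt_inv_add_pow 2 (by positivity : x + b ≠ 0)).const_mul (a * b / 2)
  have h := ((((hasDerivAt_id x).sub
    ((((hasDerivAt_id x).mul hG).sub (hS.const_mul D)).const_mul κ)).add h1).add_const
      (b / 2)).sub_const E
  refine h.congr_deriv ?_
  have : √(invLorentzSq a b c x) ≠ 0 := (Real.sqrt_pos.2 hg).ne'
  unfold redIterDeriv
  simp only [id]
  push_cast
  field_simp
  ring

/-- The two parts come from `x * quarticDecay = cubicDecay - a b / (x + b)⁴`. -/
theorem hasDerivAt_redIterDeriv (hb : 0 ≤ b) (hx : 0 < x) (hg : 0 < invLorentzSq a b c x) :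
    HasDerivAt (redIterDeriv κ a b c D)
      (convexPart κ a b c x - concavePart κ a b c D x) x := by
  have hG := hasDerivAt_invLorentzSq (a := a) (c := c) hb hx
  have hQ := hasDerivAt_cubicDecay (a := a) (c := c) hb hx
  have hpos : 0 < √(invLorentzSq a b c x) := Real.sqrt_pos.2 hg
  have hS := hG.sqrt hg.ne'
  have h1 := (hasDerivAt_inv_add_pow 3 (by positivity : x + b ≠ 0)).const_mul (a * b)
  have h := ((((hG.add (((hasDerivAt_id x).const_mul 2).mul hQ)).sub
    ((hQ.div hS hpos.ne').const_mul D)).const_mul κ).const_sub 1).sub h1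
  refine h.congr_deriv ?_
  have key : x * quarticDecay a b c x = cubicDecay a b c x - a * b * (x + b)⁻¹ ^ 4 := by
    have : x + b ≠ 0 := by positivity
    unfold quarticDecay cubicDecay
    field_simp
    ring
  unfold convexPart concavePart
  simp only [id]
  push_cast
  generalize √(invLorentzSq a b c x) = r at *
  have hne : r ≠ 0 := hpos.ne'
  have e1 : (-(3 * quarticDecay a b c x) * r - cubicDecay a b c x *
      (2 * cubicDecay a b c x / (2 * r))) / r ^ 2
      = -(3 * quarticDecay a b c x / r + cubicDecay a b c x ^ 2 / r ^ 3) := by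
    field_simp
    ring
  rw [e1]
  linear_combination (6 * κ) * key

theorem redIterDeriv_lower_bound (ha : 0 ≤ a) (hb : 0 ≤ b) (hc : 0 ≤ c) (hD : 0 < D)
    (hκ : 0 < κ) (hκ' : κ ≤ 1 / 2) (hx : 0 < x) (h : 0 ≤ invLorentzSq a b (c + D ^ 2) x) :
    invLorentzSq a b c x / 2 ≤ redIterDeriv κ a b c D x := by
  have hg := invLorentzSq_pos hD hx h
  have hq := cubicDecay_nonneg ha hb hc hx
  have hr := Real.sqrt_pos.2 hg
  -- this is `p ≥ 0`
  have hDr : D ≤ x * √(invLorentzSq a b c x) := by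
    rw [← abs_of_pos hD, ← abs_of_pos (mul_pos hx hr)]
    apply sq_le_sq.1
    rw [mul_pow, Real.sq_sqrt hg.le]
    have e : x ^ 2 * invLorentzSq a b c x - D ^ 2
        = x ^ 2 * invLorentzSq a b (c + D ^ 2) x := by
      unfold invLorentzSq
      field_simp
      ring
    nlinarith [mul_nonneg (sq_nonneg x) h]
  have h1 : D * (cubicDecay a b c x / √(invLorentzSq a b c x)) ≤ x * cubicDecay a b c x := by
    rw [← mul_div_assoc, div_le_iff₀ hr]
    nlinarith
  have h2 : 0 ≤ D * (cubicDecay a b c x / √(invLorentzSq a b c x)) := by positivity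
  have h3 : 0 ≤ x * cubicDecay a b c x := by positivity
  -- the bracket is nonnegative, so the worst case is `κ = 1 / 2`
  have h4 : κ * (invLorentzSq a b c x + 2 * x * cubicDecay a b c x
      - D * (cubicDecay a b c x / √(invLorentzSq a b c x)))
      ≤ 1 / 2 * (invLorentzSq a b c x + 2 * x * cubicDecay a b c x) := by
    exact mul_le_mul hκ' (by linarith) (by linarith) (by norm_num)
  have h5 : x * cubicDecay a b c x + a * b * (x + b)⁻¹ ^ 3 = 1 - invLorentzSq a b c x := by
    have : x + b ≠ 0 := by positivity
    unfold cubicDecay invLorentzSq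
    field_simp
    ring
  unfold redIterDeriv
  linarith

/-! ### One change of curvature -/

theorem inv_ratio_le (hb : 0 ≤ b) (hx : 0 < x) (hxy : x ≤ y) :
    (x + b)⁻¹ * y⁻¹ ≤ (y + b)⁻¹ * x⁻¹ := by
  have hy : 0 < y := hx.trans_le hxy
  rw [← mul_inv, ← mul_inv]
  apply inv_anti₀ (by positivity)
  nlinarith

theorem cubicDecay_anti (ha : 0 ≤ a) (hb : 0 ≤ b) (hc : 0 ≤ c) (hx : 0 < x) (hxy : x ≤ y) :
    cubicDecay a b c y ≤ cubicDecay a b c x := by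
  have hy : 0 < y := hx.trans_le hxy
  unfold cubicDecay
  gcongr

/-- `quarticDecay / convexPart` is decreasing. -/
theorem quarticDecay_mul_convexPart_le (ha : 0 ≤ a) (hb : 0 ≤ b) (hc : 0 ≤ c) (hκ : 0 < κ)
    (hκ' : κ ≤ 1 / 2) (hx : 0 < x) (hxy : x ≤ y) :
    quarticDecay a b c y * convexPart κ a b c x
      ≤ quarticDecay a b c x * convexPart κ a b c y := by
  have hy : 0 < y := hx.trans_le hxy
  have hr := inv_ratio_le hb hx hxy
  have hα : (y + b)⁻¹ ≤ (x + b)⁻¹ := by gcongr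
  have hβ : y⁻¹ ≤ x⁻¹ := by gcongr
  have hαβ : (x + b)⁻¹ ≤ x⁻¹ := inv_anti₀ hx (by linarith)
  have p1 : 0 < (x + b)⁻¹ := by positivity
  have p2 : 0 < (y + b)⁻¹ := by positivity
  have p3 : 0 < x⁻¹ := by positivity
  have p4 : 0 < y⁻¹ := by positivity
  unfold convexPart quarticDecay cubicDecay
  generalize (x + b)⁻¹ = α at *
  generalize (y + b)⁻¹ = α' at *
  generalize x⁻¹ = β at *
  generalize y⁻¹ = β' at *
  have r3 : (α * β') ^ 3 ≤ (α' * β) ^ 3 := by gcongr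
  have r4 : (α * β') ^ 4 ≤ (α' * β) ^ 4 := by gcongr
  have t1 : 0 ≤ α ^ 3 * α' ^ 3 * (α - α') := mul_nonneg (by positivity) (by linarith)
  have t2 : 0 ≤ β ^ 3 * β' ^ 3 * (β - β') := mul_nonneg (by positivity) (by linarith)
  -- the cross term in `a c`
  have t3 : 0 ≤ (α' * β) ^ 3 * (β - α') - (α * β') ^ 3 * (β' - α) := by
    have u1 : (α * β') ^ 3 * (β' - α) ≤ (α * β') ^ 3 * (β - α') :=
      mul_le_mul_of_nonneg_left (by linarith) (by positivity)
    have u2 := mul_le_mul_of_nonneg_right r3 (by linarith : 0 ≤ β - α')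
    linarith
  have c1 : 0 ≤ 2 * κ * a ^ 2 := by positivity
  have c2 : 0 ≤ 2 * κ * c ^ 2 := by positivity
  have c3 : 0 ≤ 2 * κ * (a * c) := by positivity
  have c4 : 0 ≤ (3 - 6 * κ) * (a * b * c) := mul_nonneg (by linarith) (by positivity)
  linear_combination mul_nonneg c1 t1 + mul_nonneg c2 t2 + mul_nonneg c3 t3
    + mul_nonneg c4 (sub_nonneg.2 r4)

/-- `cubicDecay² / convexPart` is decreasing. -/
theorem cubicDecay_sq_mul_convexPart_le (ha : 0 ≤ a) (hb : 0 ≤ b) (hc : 0 ≤ c) (hκ : 0 < κ)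
    (hκ' : κ ≤ 1 / 2) (hx : 0 < x) (hxy : x ≤ y) :
    cubicDecay a b c y ^ 2 * convexPart κ a b c x
      ≤ cubicDecay a b c x ^ 2 * convexPart κ a b c y := by
  have hy : 0 < y := hx.trans_le hxy
  have hq := cubicDecay_anti ha hb hc hx hxy
  have hqx := cubicDecay_nonneg ha hb hc hx
  have hqy := cubicDecay_nonneg ha hb hc hy
  have key : cubicDecay a b c y * (x + b)⁻¹ ^ 2 ≤ cubicDecay a b c x * (y + b)⁻¹ ^ 2 := by
    have hr := inv_ratio_le hb hx hxy
    have hα : (y + b)⁻¹ ≤ (x + b)⁻¹ := by gcongr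
    have hβ : y⁻¹ ≤ x⁻¹ := by gcongr
    have p1 : 0 < (x + b)⁻¹ := by positivity
    have p2 : 0 < (y + b)⁻¹ := by positivity
    have p3 : 0 < x⁻¹ := by positivity
    have p4 : 0 < y⁻¹ := by positivity
    unfold cubicDecay
    generalize (x + b)⁻¹ = α at *
    generalize (y + b)⁻¹ = α' at *
    generalize x⁻¹ = β at *
    generalize y⁻¹ = β' at *
    have t1 : a * ((α * α') ^ 2 * α') ≤ a * ((α * α') ^ 2 * α) := by gcongr
    have t2 : c * ((α * β') ^ 2 * β') ≤ c * ((α' * β) ^ 2 * β) := by gcongr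
    linear_combination t1 + t2
  have key2 : (cubicDecay a b c y * (x + b)⁻¹ ^ 2) ^ 2
      ≤ (cubicDecay a b c x * (y + b)⁻¹ ^ 2) ^ 2 := by gcongr
  have c1 : 0 ≤ 2 * κ * (cubicDecay a b c x * cubicDecay a b c y) := by positivity
  have c2 : 0 ≤ (3 - 6 * κ) * (a * b) := mul_nonneg (by linarith) (by positivity)
  unfold convexPart
  linear_combination mul_nonneg c1 (sub_nonneg.2 hq) + mul_nonneg c2 (sub_nonneg.2 key2)

/-- Once the second derivative of `redIter` is nonnegative, it stays so: the quotient
`concavePart / convexPart` is decreasing. -/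
theorem concavePart_le_convexPart (ha : 0 ≤ a) (hb : 0 ≤ b) (hc : 0 ≤ c) (hD : 0 < D)
    (hκ : 0 < κ) (hκ' : κ ≤ 1 / 2) (hx : 0 < x) (hg : 0 < invLorentzSq a b c x) (hxy : x ≤ y)
    (h : concavePart κ a b c D x ≤ convexPart κ a b c x) :
    concavePart κ a b c D y ≤ convexPart κ a b c y := by
  have hy : 0 < y := hx.trans_le hxy
  have hqx := cubicDecay_nonneg ha hb hc hx
  have hqy := cubicDecay_nonneg ha hb hc hy
  have hsx := quarticDecay_nonneg ha hb hc hx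
  have hw : ∀ z, 0 < z → 2 * κ * cubicDecay a b c z ≤ convexPart κ a b c z := by
    intro z hz
    have : 0 ≤ (3 - 6 * κ) * (a * b * (z + b)⁻¹ ^ 4) := mul_nonneg (by linarith) (by positivity)
    unfold convexPart
    linarith
  have hny : 0 ≤ convexPart κ a b c y := le_trans (by positivity) (hw y hy)
  have hsqrt : √(invLorentzSq a b c x) ≤ √(invLorentzSq a b c y) :=
    Real.sqrt_le_sqrt (invLorentzSq_mono ha hb hc hx hxy)
  have hr : 0 < √(invLorentzSq a b c x) := Real.sqrt_pos.2 hg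
  have hnx0 : 0 ≤ convexPart κ a b c x := le_trans (by positivity) (hw x hx)
  rcases hnx0.eq_or_lt with h0 | hnx
  · -- here `a = c = 0`
    have hq0 : cubicDecay a b c x = 0 := by nlinarith [hw x hx]
    have p1 : 0 < (x + b)⁻¹ ^ 3 := by positivity
    have p2 : 0 < x⁻¹ ^ 3 := by positivity
    have ha0 : a = 0 := by
      unfold cubicDecay at hq0
      nlinarith [mul_nonneg ha p1.le, mul_nonneg hc p2.le]
    have hc0 : c = 0 := by
      unfold cubicDecay at hq0
      nlinarith [mul_nonneg ha p1.le, mul_nonneg hc p2.le]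
    subst ha0 hc0
    simp [concavePart, convexPart, quarticDecay, cubicDecay]
  · have key : concavePart κ a b c D y * convexPart κ a b c x
        ≤ concavePart κ a b c D x * convexPart κ a b c y := by
      have k1 := quarticDecay_mul_convexPart_le ha hb hc hκ hκ' hx hxy
      have k2 := cubicDecay_sq_mul_convexPart_le ha hb hc hκ hκ' hx hxy
      have m1 : quarticDecay a b c y * convexPart κ a b c x / √(invLorentzSq a b c y)
          ≤ quarticDecay a b c x * convexPart κ a b c y / √(invLorentzSq a b c x) := by
        gcongr
      have m2 : cubicDecay a b c y ^ 2 * convexPart κ a b c x / √(invLorentzSq a b c y) ^ 3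
          ≤ cubicDecay a b c x ^ 2 * convexPart κ a b c y / √(invLorentzSq a b c x) ^ 3 := by
        gcongr
      have m3 := mul_le_mul_of_nonneg_left (add_le_add (mul_le_mul_of_nonneg_left m1
        (by norm_num : (0 : ℝ) ≤ 3)) m2) (by positivity : 0 ≤ κ * D)
      unfold concavePart
      linear_combination m3
    exact le_of_mul_le_mul_right
      (key.trans ((mul_le_mul_of_nonneg_right h hny).trans_eq (mul_comm _ _))) hnx

/-! ### Sign of the iterative function -/

/-- The point where `invLorentzSq a b (c + D²)` vanishes minimizes the convex function
`((x + b) + (D² + c) / x + a / (x + b)) / 2`, and there this function takes the value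
`redIter + E`. -/
theorem redIter_neg (ha : 0 ≤ a) (hb : 0 ≤ b) (hc : 0 ≤ c) (hD : 0 < D) (hx : 0 < x)
    (h0 : invLorentzSq a b (c + D ^ 2) x = 0) (hy : 0 < y)
    (hP : y * ((y + b) ^ 2 - 2 * E * (y + b) + D ^ 2 + (a + c)) + (D ^ 2 * b + b * c) < 0) :
    redIter κ a b c D E x < 0 := by
  have hyb : 0 < y + b := by positivity
  have hxb : 0 < x + b := by positivity
  have hE : (y + b) / 2 + (D ^ 2 + c) / 2 * y⁻¹ + a / 2 * (y + b)⁻¹ < E := by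
    have e : (y + b) / 2 + (D ^ 2 + c) / 2 * y⁻¹ + a / 2 * (y + b)⁻¹ - E
        = (y * ((y + b) ^ 2 - 2 * E * (y + b) + D ^ 2 + (a + c)) + (D ^ 2 * b + b * c))
          / (2 * (y * (y + b))) := by
      field_simp
      ring
    have := div_neg_of_neg_of_pos hP (by positivity : 0 < 2 * (y * (y + b)))
    linarith
  -- convexity of `v ↦ 1 / v`
  have tangent : ∀ u v : ℝ, 0 < u → 0 < v → 2 * u⁻¹ - v * u⁻¹ ^ 2 ≤ v⁻¹ := by
    intro u v hu hv
    have e : v⁻¹ - (2 * u⁻¹ - v * u⁻¹ ^ 2) = (u - v) ^ 2 / (v * u ^ 2) := by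
      field_simp
      ring
    have : 0 ≤ (u - v) ^ 2 / (v * u ^ 2) := by positivity
    linarith
  have t1 := mul_le_mul_of_nonneg_left (tangent x y hx hy) (by positivity : 0 ≤ (D ^ 2 + c) / 2)
  have t2 := mul_le_mul_of_nonneg_left (tangent (x + b) (y + b) hxb hyb)
    (by positivity : 0 ≤ a / 2)
  have hg : invLorentzSq a b c x = (D * x⁻¹) ^ 2 := by
    unfold invLorentzSq at *
    linear_combination h0
  have hp : x * invLorentzSq a b c x - D * √(invLorentzSq a b c x) = 0 := by
    rw [hg, Real.sqrt_sq (by positivity)]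
    field_simp
    ring
  unfold redIter
  rw [hp]
  have i1 : x * x⁻¹ = 1 := mul_inv_cancel₀ hx.ne'
  have i2 : (x + b) * (x + b)⁻¹ = 1 := mul_inv_cancel₀ hxb.ne'
  unfold invLorentzSq at h0
  have j1 : x⁻¹ = x * x⁻¹ ^ 2 := by field_simp
  have j2 : (x + b)⁻¹ = (x + b) * (x + b)⁻¹ ^ 2 := by field_simp
  have e : x + a * b / 2 * (x + b)⁻¹ ^ 2 + b / 2
      = (y + b) / 2 + (D ^ 2 + c) / 2 * (2 * x⁻¹ - y * x⁻¹ ^ 2)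
        + a / 2 * (2 * (x + b)⁻¹ - (y + b) * (x + b)⁻¹ ^ 2) := by
    rw [show 2 * x⁻¹ = 2 * (x * x⁻¹ ^ 2) by rw [← j1],
      show 2 * (x + b)⁻¹ = 2 * ((x + b) * (x + b)⁻¹ ^ 2) by rw [← j2]]
    linear_combination (x - y / 2) * h0
  linarith

/-- `redIter` has a root because its derivative is bounded below by a positive constant. -/
theorem exists_redIter_eq_zero (ha : 0 ≤ a) (hb : 0 ≤ b) (hc : 0 ≤ c) (hD : 0 < D)
    (hκ : 0 < κ) (hκ' : κ ≤ 1 / 2) (hx : 0 < x) (h0 : invLorentzSq a b (c + D ^ 2) x = 0)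
    (hneg : redIter κ a b c D E x < 0) : ∃ s, x < s ∧ redIter κ a b c D E s = 0 := by
  have hgx := invLorentzSq_pos hD hx h0.ge
  have hpos : ∀ z, x ≤ z → 0 ≤ invLorentzSq a b (c + D ^ 2) z := fun z hz =>
    h0.ge.trans (invLorentzSq_mono ha hb (by positivity) hx hz)
  have hder : ∀ z, x ≤ z →
      HasDerivAt (redIter κ a b c D E) (redIterDeriv κ a b c D z) z := fun z hz =>
    hasDerivAt_redIter hb (hx.trans_le hz) (invLorentzSq_pos hD (hx.trans_le hz) (hpos z hz))
  set k := invLorentzSq a b c x / 2 with hk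
  have hk0 : 0 < k := by positivity
  -- the slope bound `k` forces a sign change before `L`
  set L := x - redIter κ a b c D E x / k with hL
  have hxL : x < L := by
    have := div_neg_of_neg_of_pos hneg hk0
    linarith
  obtain ⟨z, hz, h⟩ := exists_hasDerivAt_eq_slope (redIter κ a b c D E) (redIterDeriv κ a b c D)
    hxL (fun w hw => (hder w hw.1).continuousAt.continuousWithinAt)
    (fun w hw => hder w hw.1.le)
  have hkz : k ≤ redIterDeriv κ a b c D z := by
    have h1 := redIterDeriv_lower_bound ha hb hc hD hκ hκ' (hx.trans hz.1) (hpos z hz.1.le)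
    have h2 := invLorentzSq_mono ha hb hc hx hz.1.le
    linarith
  rw [h, le_div_iff₀ (sub_pos.2 hxL)] at hkz
  have e : k * (L - x) = -redIter κ a b c D E x := by
    rw [hL]
    field_simp
    ring
  obtain ⟨s, hs, hs0⟩ := intermediate_value_Icc hxL.le
    (fun w hw => (hder w hw.1).continuousAt.continuousWithinAt)
    (⟨hneg.le, by linarith⟩ : (0 : ℝ) ∈ Set.Icc (redIter κ a b c D E x) (redIter κ a b c D E L))
  refine ⟨s, lt_of_le_of_ne hs.1 ?_, hs0⟩
  rintro rfl
  exact hneg.ne hs0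

theorem redIterDeriv_curvature (ha : 0 ≤ a) (hb : 0 ≤ b) (hc : 0 ≤ c) (hD : 0 < D)
    (hκ : 0 < κ) (hκ' : κ ≤ 1 / 2) {β s : ℝ} (hβ : 0 < β)
    (hg : ∀ x, β < x → 0 < invLorentzSq a b c x) (hs : β < s) :
    AntitoneOn (redIterDeriv κ a b c D) (Set.Ioc β s) ∨
      MonotoneOn (redIterDeriv κ a b c D) (Set.Ici s) := by
  have hd : ∀ x, β < x → HasDerivAt (redIterDeriv κ a b c D)
      (convexPart κ a b c x - concavePart κ a b c D x) x := fun x hx =>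
    hasDerivAt_redIterDeriv hb (hβ.trans hx) (hg x hx)
  rcases le_or_gt (concavePart κ a b c D s) (convexPart κ a b c s) with h | h
  · right
    refine monotoneOn_of_deriv_nonneg (convex_Ici s)
      (fun x hx => (hd x (hs.trans_le hx)).continuousAt.continuousWithinAt) ?_ ?_
    all_goals
      intro x hx
      rw [interior_Ici] at hx
      have hx' := hd x (hs.trans hx)
    · exact hx'.differentiableAt.differentiableWithinAt
    · rw [hx'.deriv]
      exact sub_nonneg.2 (concavePart_le_convexPart ha hb hc hD hκ hκ' (hβ.trans hs) (hg s hs)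
        (le_of_lt hx) h)
  · left
    refine antitoneOn_of_deriv_nonpos (convex_Ioc β s)
      (fun x hx => (hd x hx.1).continuousAt.continuousWithinAt) ?_ ?_
    all_goals
      intro x hx
      rw [interior_Ioc] at hx
      have hx' := hd x hx.1
    · exact hx'.differentiableAt.differentiableWithinAt
    · rw [hx'.deriv]
      refine sub_nonpos.2 (le_of_lt (lt_of_not_ge fun hle => h.not_ge ?_))
      exact concavePart_le_convexPart ha hb hc hD hκ hκ' (hβ.trans hx.1) (hg x hx.1) hx.2.le hle

end Reduced

/-! ### Reduction of the conservative variables -/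

namespace Conserved

variable {U : Conserved} {a c x : ℝ}

/-- The squared lengths of the parts of `m` perpendicular and parallel to `B`; for `B = 0` all of `m`
counts as perpendicular. -/
theorem exists_split (U : Conserved) :
    ∃ a c : ℝ, 0 ≤ a ∧ 0 ≤ c ∧ ‖U.m‖ ^ 2 = a + c ∧ U.tau ^ 2 = ‖U.B‖ ^ 2 * c := by
  have hcs : U.tau ^ 2 ≤ ‖U.m‖ ^ 2 * ‖U.B‖ ^ 2 := by
    rw [← mul_pow]
    exact sq_le_sq' (neg_le_of_abs_le (abs_real_inner_le_norm _ _)) (real_inner_le_norm _ _)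
  rcases (sq_nonneg ‖U.B‖).eq_or_lt with h | h
  · refine ⟨‖U.m‖ ^ 2, 0, sq_nonneg _, le_rfl, by ring, ?_⟩
    rw [← h, mul_zero] at hcs
    rw [mul_zero]
    exact le_antisymm hcs (sq_nonneg _)
  · refine ⟨‖U.m‖ ^ 2 - U.tau ^ 2 / ‖U.B‖ ^ 2, U.tau ^ 2 / ‖U.B‖ ^ 2, ?_, by positivity,
      by ring, (mul_div_cancel₀ _ h.ne').symm⟩
    rw [sub_nonneg, div_le_iff₀ h]
    exact hcs

theorem fa_eq (hm : ‖U.m‖ ^ 2 = a + c) (ht : U.tau ^ 2 = ‖U.B‖ ^ 2 * c) (hx : 0 < x) :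
    U.fa x = (x * (x + ‖U.B‖ ^ 2)) ^ 2 * invLorentzSq a (‖U.B‖ ^ 2) c x := by
  have : x + ‖U.B‖ ^ 2 ≠ 0 := by positivity
  unfold fa invLorentzSq
  rw [hm, ht]
  field_simp
  ring

theorem fb_eq (hm : ‖U.m‖ ^ 2 = a + c) (ht : U.tau ^ 2 = ‖U.B‖ ^ 2 * c) (hx : 0 < x) :
    U.fb x = (x * (x + ‖U.B‖ ^ 2)) ^ 2 * invLorentzSq a (‖U.B‖ ^ 2) (c + U.D ^ 2) x := by
  have : x + ‖U.B‖ ^ 2 ≠ 0 := by positivity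
  unfold fb
  rw [fa_eq hm ht hx]
  unfold invLorentzSq
  field_simp
  ring

theorem mem_Omega1 (hm : ‖U.m‖ ^ 2 = a + c) (ht : U.tau ^ 2 = ‖U.B‖ ^ 2 * c) (hx : 0 < x)
    (hg : 0 < invLorentzSq a (‖U.B‖ ^ 2) c x) : x ∈ U.Omega1 := by
  refine ⟨hx, ?_⟩
  rw [fa_eq hm ht hx]
  positivity

theorem lorentz_eq (hm : ‖U.m‖ ^ 2 = a + c) (ht : U.tau ^ 2 = ‖U.B‖ ^ 2 * c) (hx : 0 < x) :
    U.lorentz x = (√(invLorentzSq a (‖U.B‖ ^ 2) c x))⁻¹ := by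
  have : 0 < x * (x + ‖U.B‖ ^ 2) := by positivity
  unfold lorentz
  rw [fa_eq hm ht hx, Real.sqrt_mul (sq_nonneg _), Real.sqrt_sq this.le, div_mul_eq_div_div,
    div_self this.ne', one_div]

theorem thermalPressure_eq (γ : ℝ) (hD : 0 < U.D) (hm : ‖U.m‖ ^ 2 = a + c)
    (ht : U.tau ^ 2 = ‖U.B‖ ^ 2 * c) (hx : 0 < x)
    (hg : 0 < invLorentzSq a (‖U.B‖ ^ 2) c x) :
    U.thermalPressure γ x = (γ - 1) / γ * (x * invLorentzSq a (‖U.B‖ ^ 2) c x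
      - U.D * √(invLorentzSq a (‖U.B‖ ^ 2) c x)) := by
  unfold thermalPressure pressure density specificEnthalpy
  rw [lorentz_eq hm ht hx]
  have hr := Real.sqrt_pos.2 hg
  have hsq := Real.sq_sqrt hg.le
  generalize √(invLorentzSq a (‖U.B‖ ^ 2) c x) = r at *
  rw [← hsq, mul_assoc]
  congr 1
  field_simp

theorem iterFun_eq (γ : ℝ) (hD : 0 < U.D) (hm : ‖U.m‖ ^ 2 = a + c)
    (ht : U.tau ^ 2 = ‖U.B‖ ^ 2 * c) (hx : 0 < x)
    (hg : 0 < invLorentzSq a (‖U.B‖ ^ 2) c x) :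
    U.iterFun γ x = redIter ((γ - 1) / γ) a (‖U.B‖ ^ 2) c U.D U.E x := by
  unfold iterFun redIter
  rw [thermalPressure_eq γ hD hm ht hx hg, lorentz_eq hm ht hx, inv_pow, Real.sq_sqrt hg.le,
    div_inv_eq_mul, ht]
  have e : ‖U.B‖ ^ 2 * invLorentzSq a (‖U.B‖ ^ 2) c x + ‖U.B‖ ^ 2 * c / x ^ 2
      = ‖U.B‖ ^ 2 - a * ‖U.B‖ ^ 2 * (x + ‖U.B‖ ^ 2)⁻¹ ^ 2 := by
    unfold invLorentzSq
    field_simp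
    ring
  rw [e]
  ring

theorem thermalPressure_pos {γ : ℝ} (hγ : 1 < γ) (hD : 0 < U.D) (hm : ‖U.m‖ ^ 2 = a + c)
    (ht : U.tau ^ 2 = ‖U.B‖ ^ 2 * c) (hx : 0 < x)
    (h : 0 < invLorentzSq a (‖U.B‖ ^ 2) (c + U.D ^ 2) x) : 0 < U.thermalPressure γ x := by
  have hg := invLorentzSq_pos hD hx h.le
  rw [thermalPressure_eq γ hD hm ht hx hg]
  have hr := Real.sqrt_pos.2 hg
  have hDr : U.D < x * √(invLorentzSq a (‖U.B‖ ^ 2) c x) := by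
    rw [← abs_of_pos hD, ← abs_of_pos (mul_pos hx hr)]
    apply sq_lt_sq.1
    rw [mul_pow, Real.sq_sqrt hg.le]
    have e : x ^ 2 * invLorentzSq a (‖U.B‖ ^ 2) c x - U.D ^ 2
        = x ^ 2 * invLorentzSq a (‖U.B‖ ^ 2) (c + U.D ^ 2) x := by
      unfold invLorentzSq
      field_simp
      ring
    have : 0 < x ^ 2 * invLorentzSq a (‖U.B‖ ^ 2) (c + U.D ^ 2) x := by positivity
    linarith
  have h1 : 0 < (γ - 1) / γ := div_pos (by linarith) (by linarith)
  refine mul_pos h1 ?_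
  have hsq := Real.sq_sqrt hg.le
  have := mul_pos hr (sub_pos.2 hDr)
  nlinarith

theorem norm_velocity_sq (hm : ‖U.m‖ ^ 2 = a + c) (ht : U.tau ^ 2 = ‖U.B‖ ^ 2 * c) (hx : 0 < x) :
    ‖U.velocity x‖ ^ 2 = 1 - invLorentzSq a (‖U.B‖ ^ 2) c x := by
  have hxb : x + ‖U.B‖ ^ 2 ≠ 0 := by positivity
  unfold velocity
  rw [norm_smul, mul_pow, norm_add_sq_real, norm_smul, mul_pow, inner_smul_right, hm,
    Real.norm_eq_abs, Real.norm_eq_abs, sq_abs, sq_abs, mul_pow, ht]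
  change ((x + ‖U.B‖ ^ 2)⁻¹) ^ 2 * (a + c + 2 * (x⁻¹ * U.tau * U.tau) + _) = _
  rw [show x⁻¹ * U.tau * U.tau = x⁻¹ * U.tau ^ 2 by ring, ht]
  unfold invLorentzSq
  field_simp
  ring

/-- The local minimum of the cubic `y ((y + b)² - 2 E (y + b) + D² + |m|²) + D² b + τ²` lies at
`(Φ - 2 (b - E)) / 3`, and `Ψ > 0` says that this point and minus the minimum are positive. -/
theorem exists_cubic_neg (h : 0 < U.Psi) (hE : U.D ^ 2 + ‖U.m‖ ^ 2 ≤ U.E ^ 2) :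
    ∃ y, 0 < y ∧ y * ((y + ‖U.B‖ ^ 2) ^ 2 - 2 * U.E * (y + ‖U.B‖ ^ 2) + U.D ^ 2 + ‖U.m‖ ^ 2)
      + (U.D ^ 2 * ‖U.B‖ ^ 2 + U.tau ^ 2) < 0 := by
  unfold Psi at h
  have hΦ : U.Phi ^ 2 = (‖U.B‖ ^ 2 - U.E) ^ 2 + 3 * (U.E ^ 2 - U.D ^ 2 - ‖U.m‖ ^ 2) :=
    Real.sq_sqrt (by nlinarith [sq_nonneg (‖U.B‖ ^ 2 - U.E)])
  have hR : 0 ≤ 27 / 2 * (U.D ^ 2 * ‖U.B‖ ^ 2 + U.tau ^ 2) := by positivity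
  have hprod := (Real.sqrt_nonneg _).trans_lt (sub_pos.1 h)
  have h1 : 0 < U.Phi - 2 * (‖U.B‖ ^ 2 - U.E) := pos_of_mul_pos_left hprod (Real.sqrt_nonneg _)
  have h2 : 0 < √(U.Phi + ‖U.B‖ ^ 2 - U.E) := pos_of_mul_pos_right hprod h1.le
  have h3 := pow_lt_pow_left₀ (sub_pos.1 h) (Real.sqrt_nonneg _) two_ne_zero
  rw [mul_pow, Real.sq_sqrt hR, Real.sq_sqrt (Real.sqrt_pos.1 h2).le] at h3
  refine ⟨(U.Phi - 2 * (‖U.B‖ ^ 2 - U.E)) / 3, by positivity, ?_⟩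
  generalize U.Phi = p at *
  generalize ‖U.B‖ ^ 2 = b at *
  linear_combination 2 / 27 * h3 + (p - 2 * (b - U.E)) / 9 * hΦ

end Conserved

end RMHD

open RMHD in
theorem theorem3p2 (γ : ℝ) (hγ : 1 < γ) (hγ' : γ ≤ 2)
    (U : RMHD.Conserved) (hU : U ∈ RMHD.admissible) :
    ∃ ξb : ℝ, RMHD.IsUniqueRootOn U.fb U.Omega1 ξb ∧ Set.Ioi ξb ⊆ U.Omega1 ∧
      ∃ ξs : ℝ, RMHD.IsUniqueRootOn (U.iterFun γ) (Set.Ioi ξb) ξs ∧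
        ∀ ξ₀ ∈ Set.Ioc ξb ξs,
          -- no step of the iteration divides by zero or uses an undefined derivative
          (∀ n, DifferentiableAt ℝ (U.iterFun γ) (RMHD.newtonSeq (U.iterFun γ) ξ₀ n) ∧
            deriv (U.iterFun γ) (RMHD.newtonSeq (U.iterFun γ) ξ₀ n) ≠ 0) ∧
          (∀ n, RMHD.newtonSeq (U.iterFun γ) ξ₀ n ∈ Set.Ioi ξb) ∧
          RMHD.IsPCP γ U (RMHD.newtonSeq (U.iterFun γ) ξ₀) ∧
          Tendsto (RMHD.newtonSeq (U.iterFun γ) ξ₀) atTop (𝓝 ξs) := by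
  obtain ⟨hD, hE, hΨ⟩ := hU
  obtain ⟨a, c, ha, hc, hm, ht⟩ := U.exists_split
  have hb : 0 ≤ ‖U.B‖ ^ 2 := sq_nonneg _
  have hκ : 0 < (γ - 1) / γ := div_pos (by linarith) (by linarith)
  have hκ' : (γ - 1) / γ ≤ 1 / 2 := by
    rw [div_le_iff₀ (by linarith)]
    linarith
  have hE2 : U.D ^ 2 + ‖U.m‖ ^ 2 ≤ U.E ^ 2 := by
    have h1 : 0 ≤ U.D ^ 2 + ‖U.m‖ ^ 2 := by positivity
    have h2 := pow_le_pow_left₀ (Real.sqrt_nonneg _) (sub_pos.1 hE).le 2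
    rwa [Real.sq_sqrt h1] at h2
  have hcD : 0 < c + U.D ^ 2 := by positivity
  obtain ⟨ξb, hξb, h0⟩ := exists_invLorentzSq_eq_zero ha hb hc hD
  have hgb : ∀ x, ξb < x → 0 < invLorentzSq a (‖U.B‖ ^ 2) (c + U.D ^ 2) x := fun x hx =>
    h0 ▸ invLorentzSq_strictMono ha hb hcD hξb hx
  have hg : ∀ x, ξb < x → 0 < invLorentzSq a (‖U.B‖ ^ 2) c x := fun x hx =>
    invLorentzSq_pos hD (hξb.trans hx) (hgb x hx).le
  have hsub : Set.Ioi ξb ⊆ U.Omega1 := fun x hx =>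
    Conserved.mem_Omega1 hm ht (hξb.trans hx) (hg x hx)
  have hF : ∀ x, ξb < x → HasDerivAt (U.iterFun γ)
      (redIterDeriv ((γ - 1) / γ) a (‖U.B‖ ^ 2) c U.D x) x := fun x hx => by
    refine (hasDerivAt_redIter (E := U.E) hb (hξb.trans hx) (hg x hx)).congr_of_eventuallyEq ?_
    filter_upwards [Ioi_mem_nhds hx] with z hz
    exact Conserved.iterFun_eq γ hD hm ht (hξb.trans hz) (hg z hz)
  have hF' : ∀ x, ξb < x → 0 < redIterDeriv ((γ - 1) / γ) a (‖U.B‖ ^ 2) c U.D x := fun x hx =>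
    (half_pos (hg x hx)).trans_le
      (redIterDeriv_lower_bound ha hb hc hD hκ hκ' (hξb.trans hx) (hgb x hx).le)
  obtain ⟨y, hy, hP⟩ := Conserved.exists_cubic_neg hΨ hE2
  rw [hm, ht] at hP
  obtain ⟨ξs, hξs, hs0⟩ := exists_redIter_eq_zero ha hb hc hD hκ hκ' hξb h0
    (redIter_neg (E := U.E) (κ := (γ - 1) / γ) ha hb hc hD hξb h0 hy hP)
  rw [← Conserved.iterFun_eq γ hD hm ht (hξb.trans hξs) (hg ξs hξs)] at hs0
  refine ⟨ξb, ⟨Conserved.mem_Omega1 hm ht hξb (invLorentzSq_pos hD hξb h0.ge), ?_, ?_⟩, hsub,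
    ξs, ⟨hξs, hs0, fun z hz hz0 => ?_⟩, fun ξ₀ hξ₀ => ?_⟩
  · rw [Conserved.fb_eq hm ht hξb, h0, mul_zero]
  · intro z hz hz0
    have hz1 : 0 < z := hz.1
    rw [Conserved.fb_eq hm ht hz1] at hz0
    have hz2 := (mul_eq_zero.1 hz0).resolve_left (by positivity)
    rcases lt_trichotomy z ξb with h | h | h
    · exact absurd (hz2.trans h0.symm) (invLorentzSq_strictMono ha hb hcD hz1 h).ne
    · exact h
    · exact absurd hz2 (hgb z h).ne'
  · exact (strictMonoOn_of_hasDerivAt_pos hF hF').injOn hz hξs (hz0.trans hs0.symm)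
  · obtain ⟨hstay, hlim⟩ := newtonSeq_tendsto hF hF'
      (fun x hx => (hasDerivAt_redIterDeriv hb (hξb.trans hx) (hg x hx)).continuousAt) hs0
      (redIterDeriv_curvature ha hb hc hD hκ hκ' hξb hg hξs) hξ₀
    refine ⟨fun n => ⟨(hF _ (hstay n)).differentiableAt, ?_⟩, hstay, fun n => ?_, hlim⟩
    · rw [(hF _ (hstay n)).deriv]
      exact (hF' _ (hstay n)).ne'
    · have hx := hξb.trans (hstay n)
      refine ⟨hsub (hstay n), ?_, Conserved.thermalPressure_pos hγ hD hm ht hx (hgb _ (hstay n)), ?_⟩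
      · unfold Conserved.density
        rw [Conserved.lorentz_eq hm ht hx]
        exact div_pos hD (inv_pos.2 (Real.sqrt_pos.2 (hg _ (hstay n))))
      · rw [← sq_lt_one_iff₀ (norm_nonneg _), Conserved.norm_velocity_sq hm ht hx]
        linarith [hg _ (hstay n)]
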